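/- **Theorem (Denoising Score Matching Loss Lower Bound).** Let $M\subseteq\mathbb{R}^n$ be a $d$-dimensional embedded $C^1$ submanifold, and let $x$ be a random point of $M$ whose law has a probability density $p$ with respect to the $d$-dimensional volume measure of $M$. Let $\varepsilon\sim\mathcal{N}(0,I_n)$ be independent of $x$. For a noise level $\sigma>0$ and a measurable score function $s:\mathbb{R}^n\to\mathbb{R}^n$, with corresponding noise predictor $\epsilon_\theta=-\sigma s$, the denoising score matching loss is $$\mathbb{E}_{x}\big[\mathcal{L}_{\mathrm{DSM}}(x,\sigma,s)\big]=\mathbb{E}_{x,\varepsilon}\,\sigma^2\Big\|\frac{\varepsilon}{\sigma}+s(x+\sigma\varepsilon)\Big\|^2=\mathbb{E}_{x,\varepsilon}\,\big\|\varepsilon-\epsilon_\theta(x+\sigma\varepsilon)\big\|^2\in[0,\infty].$$ Then, as $\sigma\to0^+$, this loss is asymptotically at least the intrinsic dimension $d$, uniformly over all predictors: for every $\delta>0$ there is $\sigma_0>0$ (depending only on $n,d,M,p,\delta$) such that for all $0<\sigma<\sigma_0$, every measurable score function $s:\mathbb{R}^n\to\mathbb{R}^n$ satisfies $$\mathbb{E}_{x}\big[\mathcal{L}_{\mathrm{DSM}}(x,\sigma,s)\big]\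 \ge\ d-\delta ,$$ and every measurable noise predictor $\epsilon_\theta:\mathbb{R}^n\to\mathbb{R}^n$ satisfies $$\mathbb{E}_{x,\varepsilon}\,\big\|\varepsilon-\epsilon_\theta(x+\sigma\varepsilon)\big\|^2\ \ge\ d-\delta .$$ In other words, $\liminf_{\sigma\to0^+}\inf_{\epsilon_\theta}\mathbb{E}_{x,\varepsilon}\|\varepsilon-\epsilon_\theta(x+\sigma\varepsilon)\|^2\ge d$. -/

import Mathlib

open MeasureTheory ProbabilityTheory
open scoped ENNReal

/-- `M ⊆ ℝⁿ` is a `d`-dimensional embedded `C¹` submanifold: around each of its points `M` is the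
image of a `C¹` parametrization, defined on an open subset of `ℝᵈ`, with injective derivative and
which is a homeomorphism onto a (relatively open) neighbourhood of the point in `M`. -/
def IsEmbeddedSubmanifold {n : ℕ} (d : ℕ) (M : Set (EuclideanSpace ℝ (Fin n))) : Prop :=
  ∀ x ∈ M, ∃ (U : Set (EuclideanSpace ℝ (Fin n))) (V : Set (EuclideanSpace ℝ (Fin d)))
    (f : EuclideanSpace ℝ (Fin d) → EuclideanSpace ℝ (Fin n)),
    IsOpen U ∧ x ∈ U ∧ IsOpen V ∧ ContDiffOn ℝ 1 f V ∧
    (∀ v ∈ V, Function.Injective (fderiv ℝ f v)) ∧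
    Topology.IsEmbedding (V.domRestrict f) ∧ f '' V = M ∩ U

/-- The `d`-dimensional volume measure of `M`: the `d`-dimensional Hausdorff measure on `M`,
normalized so as to agree with Lebesgue measure on `d`-dimensional Euclidean spaces. -/
noncomputable def volumeOn {n : ℕ} (d : ℕ) (M : Set (EuclideanSpace ℝ (Fin n))) :
    Measure (EuclideanSpace ℝ (Fin n)) :=
  (Measure.euclideanHausdorffMeasure d).restrict M

/-- The law with density `p` with respect to the `d`-dimensional volume measure of `M`. -/
noncomputable def dataLaw {n : ℕ} (d : ℕ) (M : Set (EuclideanSpace ℝ (Fin n)))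
    (p : EuclideanSpace ℝ (Fin n) → ℝ≥0∞) : Measure (EuclideanSpace ℝ (Fin n)) :=
  (volumeOn d M).withDensity p

/-- The denoising score matching loss of the score function `s` at the point `x` and noise level
`σ`, namely `E_ε σ² ‖ε / σ + s (x + σ ε)‖²` with `ε` standard Gaussian in `ℝⁿ`. It takes values in
`[0, ∞]`. -/
noncomputable def dsmLoss {n : ℕ} (s : EuclideanSpace ℝ (Fin n) → EuclideanSpace ℝ (Fin n))
    (σ : ℝ) (x : EuclideanSpace ℝ (Fin n)) : ℝ≥0∞ :=
  ∫⁻ ε, ENNReal.ofReal (σ ^ 2 * ‖σ⁻¹ • ε + s (x + σ • ε)‖ ^ 2)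
    ∂(stdGaussian (EuclideanSpace ℝ (Fin n)))

/-- The same loss in the noise prediction parametrization, `E_ε ‖ε - εθ (x + σ ε)‖²` with `ε`
standard Gaussian in `ℝⁿ`. -/
noncomputable def noisePredictionLoss {n : ℕ}
    (εθ : EuclideanSpace ℝ (Fin n) → EuclideanSpace ℝ (Fin n))
    (σ : ℝ) (x : EuclideanSpace ℝ (Fin n)) : ℝ≥0∞ :=
  ∫⁻ ε, ENNReal.ofReal (‖ε - εθ (x + σ • ε)‖ ^ 2)
    ∂(stdGaussian (EuclideanSpace ℝ (Fin n)))

/-- The two forms of the loss agree when `εθ = -σ s`. -/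
theorem dsmLoss_eq_noisePredictionLoss {n : ℕ}
    (s : EuclideanSpace ℝ (Fin n) → EuclideanSpace ℝ (Fin n)) {σ : ℝ} (hσ : σ ≠ 0)
    (x : EuclideanSpace ℝ (Fin n)) :
    dsmLoss s σ x = noisePredictionLoss (fun y => -(σ • s y)) σ x := by
  unfold dsmLoss noisePredictionLoss
  congr 1
  funext ε
  congr 1
  rw [← sq_abs σ, ← mul_pow, ← Real.norm_eq_abs, ← norm_smul, smul_add, smul_inv_smul₀ hσ,
    sub_neg_eq_add]

/-!
The observation is `y = x + σ z` with `x` of law `dataLaw d M p` and `z` a standard Gaussian vector.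
The claim holds because the `d` components of `z` tangent to `M` cannot be predicted from `y` when
`σ` is small: moving `x` along `M` by a distance of order `σ`, which hardly changes the density of
`x`, has the same effect on `y` as changing the tangential noise.

To make this precise, let `x = f v` for a `C¹` parametrization `f`, let `v` have a smooth compactly
supported density `c`, and let `G` be bounded and measurable. Integrating the derivative of
`v ↦ c v * φ ((y - f v) / σ)` along `w`, where `φ` is the Gaussian density, gives
`E[G(y) ⟪z, Df(v) w⟫] = O(σ)` with a constant depending only on the derivative of `c` and on a bound
for `G` (`integral_mul_integral_inner_fderiv`, `abs_integral_mul_integral_inner_fderiv_le`). By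
density of smooth functions in `L¹`, this expectation tends to `0`, uniformly in `|G| ≤ 1`, for any
integrable density (`eventually_abs_integral_inner_fderiv_le`).

If the components `⟪z, u i⟫` along an orthonormal family `u` are nearly uncorrelated with bounded
functions of `y`, expand `(⟪z, u i⟫ - ⟪g y, u i⟫) ^ 2`, after truncating the predictor `g` at a level
`R`. The truncation costs at most a Gaussian third moment over `R` (`sq_sub_clip_le`), the cross term
is small, and `E ⟪z, u i⟫ ^ 2 = 1`; summing over `i` bounds the loss below by almost `d`
(`ofReal_le_lintegral_norm_sub_sq`).

The loss is additive in the law of `x`, and a lower bound uniform over predictors on each piece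
gives one on the sum. So `M` is covered by countably many pieces on which tangent vectors vary
little, finitely many of which carry almost all of the mass. On each of them the data law is the
image under the parametrization of an absolutely continuous measure, since Lipschitz maps preserve
`d`-dimensional null sets (`exists_map_eq_of_absolutelyContinuous`).
-/

/-! ### The standard Gaussian and its density -/

/-- The density of the standard Gaussian of a Euclidean space with respect to Lebesgue measure. -/
noncomputable def gaussianDensity {E : Type*} [NormedAddCommGroup E] [InnerProductSpace ℝ E]
    (z : E) : ℝ :=
  (2 * Real.pi) ^ (-(Module.finrank ℝ E / 2 : ℝ)) * Real.exp (-(1 / 2) * ‖z‖ ^ 2)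

section Gaussian

variable {E : Type*} [NormedAddCommGroup E] [InnerProductSpace ℝ E]

local notation "⟪" x ", " y "⟫" => inner ℝ x y

theorem gaussianDensity_nonneg (z : E) : 0 ≤ gaussianDensity z := by
  unfold gaussianDensity; positivity

theorem contDiff_gaussianDensity : ContDiff ℝ 1 (gaussianDensity : E → ℝ) := by
  unfold gaussianDensity
  exact contDiff_const.mul (Real.contDiff_exp.comp (contDiff_const.mul (contDiff_norm_sq ℝ)))

theorem hasFDerivAt_gaussianDensity (z : E) :
    HasFDerivAt gaussianDensity (-(gaussianDensity z) • innerSL ℝ z) z := by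
  have h := (((hasStrictFDerivAt_norm_sq z).hasFDerivAt.const_mul (-(1 / 2) : ℝ)).exp).const_mul
    ((2 * Real.pi) ^ (-(Module.finrank ℝ E / 2 : ℝ)))
  refine h.congr_fderiv ?_
  ext u
  simp [gaussianDensity]
  ring

variable [FiniteDimensional ℝ E] [MeasurableSpace E] [BorelSpace E]

theorem integrable_gaussianDensity : Integrable (gaussianDensity : E → ℝ) := by
  have h := (GaussianFourier.integrable_cexp_neg_mul_sq_norm_add (V := E) (b := 1 / 2)
    (by norm_num) 0 0).norm
  refine (h.congr (ae_of_all _ fun z => ?_)).const_mul _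
  simp [Complex.norm_exp, ← Complex.ofReal_pow]

/-- Both measures have the same characteristic function. -/
theorem stdGaussian_eq_withDensity :
    stdGaussian E = volume.withDensity fun z => ENNReal.ofReal (gaussianDensity z) := by
  have : IsFiniteMeasure (volume.withDensity fun z : E => ENNReal.ofReal (gaussianDensity z)) :=
    isFiniteMeasure_withDensity_ofReal integrable_gaussianDensity.2
  refine Measure.ext_of_charFun ?_
  ext t
  rw [charFun_stdGaussian, charFun_apply, integral_withDensity_eq_integral_toReal_smul
    (contDiff_gaussianDensity.continuous.measurable.ennreal_ofReal) (by simp)]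
  have h := GaussianFourier.integral_cexp_neg_mul_sq_norm_add (V := E) (b := 1 / 2)
    (by norm_num) Complex.I t
  have hpos : (0 : ℝ) < 2 * Real.pi := by positivity
  calc _ = Complex.exp (Complex.I ^ 2 * ‖t‖ ^ 2 / (4 * (1 / 2))) := by
        rw [Complex.I_sq]; congr 1; ring
    _ = ((2 * Real.pi) ^ (-(Module.finrank ℝ E / 2 : ℝ)) : ℝ) *
          ∫ v : E, Complex.exp (-(1 / 2) * ‖v‖ ^ 2 + Complex.I * ⟪t, v⟫) := by
        rw [h, ← mul_assoc]
        have : ((Real.pi : ℂ) / (1 / 2)) ^ (Module.finrank ℝ E / 2 : ℂ) =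
            (((2 * Real.pi) ^ (Module.finrank ℝ E / 2 : ℝ) : ℝ) : ℂ) := by
          rw [Complex.ofReal_cpow hpos.le]
          push_cast
          congr 1
          ring
        rw [this, ← Complex.ofReal_mul, ← Real.rpow_add hpos]
        simp
    _ = _ := by
        rw [← integral_const_mul]
        refine integral_congr_ae (ae_of_all _ fun v => ?_)
        dsimp only
        rw [ENNReal.toReal_ofReal (gaussianDensity_nonneg v)]
        simp only [gaussianDensity, Complex.exp_add, Complex.real_smul, real_inner_comm v t]
        push_cast
        rw [mul_comm Complex.I]
        ring

theorem integral_stdGaussian (h : E → ℝ) :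
    ∫ z, h z ∂(stdGaussian E) = ∫ z, gaussianDensity z * h z := by
  rw [stdGaussian_eq_withDensity, integral_withDensity_eq_integral_toReal_smul
    (contDiff_gaussianDensity.continuous.measurable.ennreal_ofReal) (by simp)]
  simp [ENNReal.toReal_ofReal, gaussianDensity_nonneg]

theorem integrable_stdGaussian_iff (h : E → ℝ) :
    Integrable h (stdGaussian E) ↔ Integrable fun z => gaussianDensity z * h z := by
  rw [stdGaussian_eq_withDensity, integrable_withDensity_iff_integrable_smul'
    (contDiff_gaussianDensity.continuous.measurable.ennreal_ofReal) (by simp)]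
  simp [ENNReal.toReal_ofReal, gaussianDensity_nonneg]

theorem integrable_norm_stdGaussian : Integrable (fun z : E => ‖z‖) (stdGaussian E) :=
  (IsGaussian.integrable_id (μ := stdGaussian E)).norm

theorem integrable_norm_pow_three_stdGaussian :
    Integrable (fun z : E => ‖z‖ ^ 3) (stdGaussian E) :=
  (IsGaussian.memLp_id (stdGaussian E) 3 (by simp)).integrable_norm_pow (by simp)

theorem integral_inner_sq_stdGaussian (u : E) :
    ∫ z, ⟪z, u⟫ ^ 2 ∂(stdGaussian E) = ‖u‖ ^ 2 := by
  have h := variance_dual_stdGaussian (innerSL ℝ u)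
  rw [variance_of_integral_eq_zero (by fun_prop) (integral_strongDual_stdGaussian _),
    innerSL_apply_norm] at h
  simpa [real_inner_comm] using h

theorem integrable_inner_sq_stdGaussian (u : E) :
    Integrable (fun z => ⟪z, u⟫ ^ 2) (stdGaussian E) :=
  ((IsGaussian.memLp_two_id (μ := stdGaussian E)).integrable_norm_pow (by simp)).mul_const (‖u‖ ^ 2)
    |>.mono' (by fun_prop) (ae_of_all _ fun z => by
      rw [Real.norm_of_nonneg (by positivity), ← mul_pow, ← sq_abs]
      exact pow_le_pow_left₀ (abs_nonneg _) (abs_real_inner_le_norm _ _) 2)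

/-! ### Integration by parts along a parametrization -/

variable {F : Type*} [NormedAddCommGroup F] [NormedSpace ℝ F] [FiniteDimensional ℝ F]
  [MeasurableSpace F] [BorelSpace F]

theorem integral_fderiv_apply_eq_zero (μ : Measure F) [μ.IsAddHaarMeasure] {g : F → ℝ}
    (hg : ContDiff ℝ 1 g) (hc : HasCompactSupport g) (w : F) : ∫ v, fderiv ℝ g v w ∂μ = 0 := by
  have h := integral_mul_fderiv_eq_neg_fderiv_mul_of_integrable (μ := μ) (f := fun _ : F => (1 : ℝ))
    (g := g) (v := w) (by simp)
    (by
      simp only [one_mul]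
      exact ((hg.continuous_fderiv_apply one_ne_zero).comp (.prodMk_left w)
        ).integrable_of_hasCompactSupport (hc.fderiv_apply ℝ w))
    (by simpa using hg.continuous.integrable_of_hasCompactSupport hc)
    (fun x _ => by fun_prop) (fun x _ => hg.differentiable one_ne_zero x)
  simpa using h

/-- Gaussian integration by parts along a parametrization `f`. For fixed `y`, the function
`v ↦ c v * φ (y - f v)`, with `φ` the Gaussian density, has compact support, so its derivative along
`w` has integral zero; integrating this against `G y` and exchanging the integrals gives the
identity. No regularity of `G` is needed. -/
theorem integral_mul_integral_inner_fderiv (μ : Measure F) [μ.IsAddHaarMeasure] {c : F → ℝ}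
    (hc : ContDiff ℝ 1 c) (hcs : HasCompactSupport c) {f : F → E} (hf : ContDiff ℝ 1 f)
    {G : E → ℝ} (hG : Measurable G) (hb : ∀ y, |G y| ≤ 1) (w : F) :
    ∫ v, c v * ∫ z, G (f v + z) * ⟪z, fderiv ℝ f v w⟫ ∂(stdGaussian E) ∂μ =
      -∫ v, fderiv ℝ c v w * ∫ z, G (f v + z) ∂(stdGaussian E) ∂μ := by
  have hDf : Continuous fun v => fderiv ℝ f v w :=
    (hf.continuous_fderiv_apply one_ne_zero).comp (.prodMk_left w)
  have hDc : Continuous fun v => fderiv ℝ c v w :=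
    (hc.continuous_fderiv_apply one_ne_zero).comp (.prodMk_left w)
  have hφ : Continuous (gaussianDensity : E → ℝ) := contDiff_gaussianDensity.continuous
  have hfc := hf.continuous
  have hcc := hc.continuous
  set k₁ : F × E → ℝ := fun q =>
    c q.1 * (gaussianDensity q.2 * (G (f q.1 + q.2) * ⟪q.2, fderiv ℝ f q.1 w⟫)) with hk₁
  set k₂ : F × E → ℝ := fun q =>
    fderiv ℝ c q.1 w * (gaussianDensity q.2 * G (f q.1 + q.2)) with hk₂
  have hGm : Measurable fun q : F × E => G (f q.1 + q.2) := hG.comp (by fun_prop)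
  have hi₁ : Integrable k₁ (μ.prod volume) := by
    have h1 : Integrable (fun v => |c v| * ‖fderiv ℝ f v w‖) μ :=
      (hcc.abs.mul hDf.norm).integrable_of_hasCompactSupport (hcs.abs.mul_right)
    have h2 := (integrable_stdGaussian_iff (E := E) _).1 integrable_norm_stdGaussian
    refine (h1.mul_prod h2).mono' ?_ (ae_of_all _ fun q => ?_)
    · refine Measurable.aestronglyMeasurable ?_
      have : Continuous fun q : F × E => ⟪q.2, fderiv ℝ f q.1 w⟫ := by fun_prop
      exact (by fun_prop : Measurable fun q : F × E => c q.1).mul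
        ((by fun_prop : Measurable fun q : F × E => gaussianDensity q.2).mul
          (hGm.mul this.measurable))
    · rw [hk₁]
      simp only [norm_mul, Real.norm_eq_abs]
      have h3 := abs_real_inner_le_norm q.2 (fderiv ℝ f q.1 w)
      rw [abs_of_nonneg (gaussianDensity_nonneg q.2)]
      have := gaussianDensity_nonneg q.2
      calc _ ≤ |c q.1| * (gaussianDensity q.2 * (1 * (‖q.2‖ * ‖fderiv ℝ f q.1 w‖))) := by
            gcongr; exact hb _
        _ = _ := by ring
  have hi₂ : Integrable k₂ (μ.prod volume) := by
    have h1 : Integrable (fun v => fderiv ℝ c v w) μ :=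
      hDc.integrable_of_hasCompactSupport (hcs.fderiv_apply ℝ w)
    have h2 := (h1.norm.mul_prod (integrable_gaussianDensity (E := E)))
    refine h2.mono' ?_ (ae_of_all _ fun q => ?_)
    · refine Measurable.aestronglyMeasurable ?_
      exact (by fun_prop : Measurable fun q : F × E => fderiv ℝ c q.1 w).mul
        ((by fun_prop : Measurable fun q : F × E => gaussianDensity q.2).mul hGm)
    · rw [hk₂]
      simp only [norm_mul, Real.norm_eq_abs]
      rw [abs_of_nonneg (gaussianDensity_nonneg q.2)]
      have := gaussianDensity_nonneg q.2
      calc _ ≤ |fderiv ℝ c q.1 w| * (gaussianDensity q.2 * 1) := by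
            gcongr; exact hb _
        _ = _ := by ring
  set k : F × E → ℝ := fun q => k₁ q + k₂ q with hk
  have hi : Integrable k (μ.prod volume) := hi₁.add hi₂
  have hmp : MeasurePreserving (fun q : F × E => (q.1, q.2 - f q.1)) (μ.prod volume)
      (μ.prod volume) :=
    (MeasurePreserving.id μ).skew_product (g := fun v y => y - f v)
      (by fun_prop)
      (ae_of_all _ fun v => (measurePreserving_sub_right volume (f v)).map_eq)
  have hi' : Integrable (fun q : F × E => k (q.1, q.2 - f q.1)) (μ.prod volume) :=
    hmp.integrable_comp_of_integrable hi
  have hzero : ∀ y, ∫ v, k (v, y - f v) ∂μ = 0 := by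
    intro y
    have hg : ContDiff ℝ 1 fun v => c v * gaussianDensity (y - f v) :=
      hc.mul (contDiff_gaussianDensity.comp (contDiff_const.sub hf))
    have h0 := integral_fderiv_apply_eq_zero μ hg hcs.mul_right w
    have h1 : ∀ v, k (v, y - f v) =
        G y * fderiv ℝ (fun v => c v * gaussianDensity (y - f v)) v w := by
      intro v
      have hd := (hc.differentiable one_ne_zero v).hasFDerivAt.mul
        ((hasFDerivAt_gaussianDensity (y - f v)).comp v
          ((hf.differentiable one_ne_zero v).hasFDerivAt.const_sub y))
      rw [show (fun v => c v * gaussianDensity (y - f v)) =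
        c * (gaussianDensity ∘ fun v => y - f v) from rfl, hd.fderiv]
      simp [hk, hk₁, hk₂, inner_sub_left]
      ring
    simp_rw [h1, integral_const_mul, h0, mul_zero]
  have hsum : ∫ v, ∫ z, k (v, z) ∂volume ∂μ = 0 := by
    have h1 : ∀ v, ∫ z, k (v, z) = ∫ y, k (v, y - f v) := fun v =>
      (integral_sub_right_eq_self (fun z => k (v, z)) (f v)).symm
    simp_rw [h1]
    rw [integral_integral_swap (f := fun v y => k (v, y - f v)) hi']
    simp [hzero]
  have hsplit : ∫ v, ∫ z, k (v, z) ∂volume ∂μ =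
      ∫ v, ∫ z, k₁ (v, z) ∂volume ∂μ + ∫ v, ∫ z, k₂ (v, z) ∂volume ∂μ :=
    integral_integral_add hi₁ hi₂
  simp only [hk₁, hk₂, integral_const_mul, ← integral_stdGaussian] at hsplit
  linarith

end Gaussian

/-! ### Tangential noise decorrelates from the observation -/

section Decorrelation

variable {E : Type*} [NormedAddCommGroup E] [InnerProductSpace ℝ E] [FiniteDimensional ℝ E]
  [MeasurableSpace E] [BorelSpace E]
  {F : Type*} [NormedAddCommGroup F] [NormedSpace ℝ F] [FiniteDimensional ℝ F]
  [MeasurableSpace F] [BorelSpace F]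

local notation "⟪" x ", " y "⟫" => inner ℝ x y

/-- For the latent law with smooth density `c`, integration by parts moves the derivative onto `c`
and gains a factor `σ`. -/
theorem abs_integral_mul_integral_inner_fderiv_le (μ : Measure F) [μ.IsAddHaarMeasure] {c : F → ℝ}
    (hc : ContDiff ℝ 1 c) (hcs : HasCompactSupport c) {f : F → E} (hf : ContDiff ℝ 1 f)
    {G : E → ℝ} (hG : Measurable G) (hb : ∀ y, |G y| ≤ 1) (w : F) {σ : ℝ} (hσ : 0 < σ) :
    |∫ v, c v * ∫ z, G (f v + σ • z) * ⟪z, fderiv ℝ f v w⟫ ∂(stdGaussian E) ∂μ| ≤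
      σ * ∫ v, |fderiv ℝ c v w| ∂μ := by
  -- After rescaling `f` and `G` by `σ` the noise level is `1`.
  have h := integral_mul_integral_inner_fderiv μ hc hcs (f := fun v => σ⁻¹ • f v)
    (hf.const_smul σ⁻¹) (G := fun y => G (σ • y)) (hG.comp (by fun_prop)) (fun y => hb _) w
  have hd : ∀ v, fderiv ℝ (fun v => σ⁻¹ • f v) v w = σ⁻¹ • fderiv ℝ f v w := fun v => by
    rw [fderiv_fun_const_smul (hf.differentiable one_ne_zero v)]; rfl
  simp_rw [hd, smul_add, smul_inv_smul₀ hσ.ne', real_inner_smul_right, mul_left_comm _ σ⁻¹,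
    integral_const_mul, mul_left_comm _ σ⁻¹, integral_const_mul] at h
  have h2 : ∫ v, c v * ∫ z, G (f v + σ • z) * ⟪z, fderiv ℝ f v w⟫ ∂(stdGaussian E) ∂μ =
      σ * -∫ v, fderiv ℝ c v w * ∫ z, G (f v + σ • z) ∂(stdGaussian E) ∂μ := by
    rw [← h, mul_inv_cancel_left₀ hσ.ne']
  rw [h2, abs_mul, abs_of_pos hσ, abs_neg]
  gcongr
  have hDc : Continuous fun v => fderiv ℝ c v w :=
    (hc.continuous_fderiv_apply one_ne_zero).comp (.prodMk_left w)
  have h1 : Integrable (fun v => fderiv ℝ c v w) μ :=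
    hDc.integrable_of_hasCompactSupport (hcs.fderiv_apply ℝ w)
  refine norm_integral_le_of_norm_le (f := fun v =>
    fderiv ℝ c v w * ∫ z, G (f v + σ • z) ∂(stdGaussian E)) h1.abs (ae_of_all _ fun v => ?_)
  rw [norm_mul, Real.norm_eq_abs]
  refine mul_le_of_le_one_right (abs_nonneg _) ?_
  simpa using norm_integral_le_of_norm_le (f := fun z => G (f v + σ • z))
    (integrable_const (μ := stdGaussian E) (1 : ℝ)) (ae_of_all _ fun z => hb _)

open Filter Topology in
/-- If `x = f v` where `v` has a density, then the noise component along the tangent vector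
`Df(v) w` becomes uncorrelated, as `σ → 0`, with every bounded function of the observation
`x + σ z`, uniformly over these functions. The density of `v` is approximated in `L¹` by a smooth
one, to which integration by parts applies. -/
theorem eventually_abs_integral_inner_fderiv_le (μ : Measure F) [μ.IsAddHaarMeasure] (ν : Measure F)
    [IsFiniteMeasure ν] (hν : ν ≪ μ) {f : F → E} (hf : ContDiff ℝ 1 f) (w : F) {C : ℝ}
    (hC : ∀ v, ‖fderiv ℝ f v w‖ ≤ C) {κ : ℝ} (hκ : 0 < κ) :
    ∀ᶠ σ in 𝓝[>] (0 : ℝ), ∀ G : E → ℝ, Measurable G → (∀ y, |G y| ≤ 1) →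
      |∫ v, ∫ z, G (f v + σ • z) * ⟪z, fderiv ℝ f v w⟫ ∂(stdGaussian E) ∂ν| ≤ κ := by
  have hC0 : 0 ≤ C := (norm_nonneg _).trans (hC 0)
  set A : ℝ := ∫ z : E, ‖z‖ ∂(stdGaussian E) with hA
  have hA0 : 0 ≤ A := integral_nonneg fun _ => norm_nonneg _
  set q : F → ℝ := fun v => (ν.rnDeriv μ v).toReal with hq
  have hqi : Integrable q μ := Measure.integrable_toReal_rnDeriv
  set ε : ℝ := κ / 2 / (A * C + 1) with hε
  have hε0 : 0 < ε := by positivity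
  obtain ⟨c, hcs, hc, hqc⟩ :=
    (memLp_one_iff_integrable.2 hqi).exist_eLpNorm_sub_le ENNReal.one_ne_top le_rfl hε0
  have hc : ContDiff ℝ 1 c := hc.of_le (by exact_mod_cast le_top)
  have hci : Integrable c μ := hc.continuous.integrable_of_hasCompactSupport hcs
  have hdiff : ∫ v, |q v - c v| ∂μ ≤ ε := by
    have h : ∫ v, |q v - c v| ∂μ = (eLpNorm (q - c) 1 μ).toReal := by
      rw [eLpNorm_one_eq_lintegral_enorm, ← integral_norm_eq_lintegral_enorm
        (hqi.sub hci).aestronglyMeasurable]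
      rfl
    rw [h]
    exact ENNReal.toReal_le_of_le_ofReal hε0.le hqc
  set L : ℝ := ∫ v, |fderiv ℝ c v w| ∂μ with hL
  have hL0 : 0 ≤ L := integral_nonneg fun _ => abs_nonneg _
  filter_upwards [Ioo_mem_nhdsGT (show 0 < κ / 2 / (L + 1) by positivity)] with σ ⟨hσ, hσ'⟩ G hG hb
  set H : F → ℝ := fun v => ∫ z, G (f v + σ • z) * ⟪z, fderiv ℝ f v w⟫ ∂(stdGaussian E) with hH
  have hHm : AEStronglyMeasurable H μ := by
    have hDf : Continuous fun v => fderiv ℝ f v w :=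
      (hf.continuous_fderiv_apply one_ne_zero).comp (.prodMk_left w)
    have hfc := hf.continuous
    have h1 : Measurable fun p : F × E => G (f p.1 + σ • p.2) * ⟪p.2, fderiv ℝ f p.1 w⟫ :=
      (hG.comp (by fun_prop)).mul
        (by fun_prop : Continuous fun p : F × E => ⟪p.2, fderiv ℝ f p.1 w⟫).measurable
    exact h1.stronglyMeasurable.integral_prod_right.aestronglyMeasurable
  have hHb : ∀ v, ‖H v‖ ≤ A * C := fun v => by
    rw [hA, ← integral_mul_const]
    refine norm_integral_le_of_norm_le (integrable_norm_stdGaussian.mul_const C)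
      (ae_of_all _ fun z => ?_)
    rw [norm_mul, Real.norm_eq_abs, Real.norm_eq_abs]
    calc _ ≤ 1 * (‖z‖ * ‖fderiv ℝ f v w‖) := by
          gcongr
          exacts [hb _, abs_real_inner_le_norm _ _]
      _ ≤ ‖z‖ * C := by rw [one_mul]; gcongr; exact hC v
  have hcH : Integrable (fun v => c v * H v) μ := hci.mul_bdd (c := A * C) hHm (ae_of_all _ hHb)
  have hdH : Integrable (fun v => (q v - c v) * H v) μ :=
    (hqi.sub hci).mul_bdd (c := A * C) hHm (ae_of_all _ hHb)
  have hsplit : ∫ v, H v ∂ν = ∫ v, (q v - c v) * H v ∂μ + ∫ v, c v * H v ∂μ := by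
    rw [← integral_rnDeriv_smul hν, ← integral_add hdH hcH]
    refine integral_congr_ae (ae_of_all _ fun v => ?_)
    simp only [smul_eq_mul, hq]
    ring
  have h1 : |∫ v, (q v - c v) * H v ∂μ| ≤ κ / 2 := by
    calc _ ≤ ∫ v, |q v - c v| * (A * C) ∂μ := by
          refine norm_integral_le_of_norm_le (f := fun v => (q v - c v) * H v)
            ((hqi.sub hci).abs.mul_const _) (ae_of_all _ fun v => ?_)
          rw [norm_mul]
          exact mul_le_mul_of_nonneg_left (hHb v) (norm_nonneg _)
      _ ≤ ε * (A * C + 1) := by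
          rw [integral_mul_const]
          gcongr
          linarith
      _ = κ / 2 := by rw [hε]; field_simp
  have h2 : |∫ v, c v * H v ∂μ| ≤ κ / 2 := by
    calc _ ≤ σ * L := abs_integral_mul_integral_inner_fderiv_le μ hc hcs hf hG hb w hσ
      _ ≤ κ / 2 / (L + 1) * (L + 1) := by
          gcongr
          linarith
      _ = κ / 2 := by field_simp
  calc _ = |∫ v, (q v - c v) * H v ∂μ + ∫ v, c v * H v ∂μ| := by rw [← hsplit]
    _ ≤ _ := abs_add_le _ _
    _ ≤ κ := by linarith

end Decorrelation

/-! ### From decorrelation to a lower bound on the loss -/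

/-- Truncating the predictor `g` at level `R` costs at most a third moment. -/
theorem sq_sub_clip_le (e g : ℝ) {R : ℝ} (hR : 0 < R) :
    e ^ 2 - 2 * (e * max (-R) (min R g)) - 3 * (|e| ^ 3 / R) ≤ (e - g) ^ 2 := by
  set t := max (-R) (min R g) with ht
  have ht1 : -R ≤ t := le_max_left _ _
  have ht2 : t ≤ R := max_le (by linarith) (min_le_left _ _)
  rcases le_or_gt |e| R with he | he
  · have hcube : 0 ≤ |e| ^ 3 / R := by positivity
    obtain ⟨h1, h2⟩ := abs_le.1 he
    have : (e - t) ^ 2 ≤ (e - g) ^ 2 := by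
      -- Clipping is the projection onto `[-R, R]`, which contains `e`.
      rw [sq_le_sq]
      rcases le_total g R with hg | hg
      · rcases le_total (-R) g with hg' | hg'
        · rw [ht, min_eq_right hg, max_eq_right hg']
        · rw [ht, min_eq_right hg, max_eq_left hg', abs_of_nonneg (by linarith),
            abs_of_nonneg (by linarith)]
          linarith
      · rw [ht, min_eq_left hg, max_eq_right (by linarith), abs_of_nonpos (by linarith),
          abs_of_nonpos (by linarith)]
        linarith
    nlinarith [sq_nonneg t]
  · have h1 : |e| ^ 2 ≤ |e| ^ 3 / R := by
      rw [le_div_iff₀ hR]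
      nlinarith [sq_nonneg |e|]
    have h2 : |e * t| ≤ |e| ^ 2 := by
      rw [abs_mul, sq]
      exact mul_le_mul_of_nonneg_left ((abs_le.2 ⟨ht1, ht2⟩).trans he.le) (abs_nonneg _)
    have h3 := neg_abs_le (e * t)
    rw [sq_abs] at h1 h2
    nlinarith [sq_nonneg (e - g)]

theorem ofReal_integral_le_lintegral_ofReal {α : Type*} [MeasurableSpace α] {μ : Measure α}
    {h : α → ℝ} (hi : Integrable h μ) :
    ENNReal.ofReal (∫ a, h a ∂μ) ≤ ∫⁻ a, ENNReal.ofReal (h a) ∂μ := by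
  rw [integral_eq_lintegral_pos_part_sub_lintegral_neg_part hi]
  exact (ENNReal.ofReal_le_ofReal (sub_le_self _ ENNReal.toReal_nonneg)).trans
    ENNReal.ofReal_toReal_le

section Loss

variable {E : Type*} [NormedAddCommGroup E] [InnerProductSpace ℝ E] [FiniteDimensional ℝ E]
  [MeasurableSpace E] [BorelSpace E]

local notation "⟪" x ", " y "⟫" => inner ℝ x y

/-- Suppose that the noise components along the orthonormal vectors `u i` are nearly uncorrelated
with bounded functions of the observation. Then no predictor does much better in these directions
than the zero predictor, whose loss in each of them is `1`. -/
theorem ofReal_le_lintegral_norm_sub_sq {ι : Type*} [Fintype ι] (ρ : Measure E) [IsFiniteMeasure ρ]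
    {u : ι → E} (hu : Orthonormal ℝ u) {R κ σ : ℝ} (hR : 0 < R)
    (hdec : ∀ G : E → ℝ, Measurable G → (∀ y, |G y| ≤ 1) → ∀ i,
      |∫ x, ∫ z, G (x + σ • z) * ⟪z, u i⟫ ∂(stdGaussian E) ∂ρ| ≤ κ * ρ.real Set.univ)
    {g : E → E} (hg : Measurable g) :
    ENNReal.ofReal (Fintype.card ι *
        (1 - 2 * (R * κ) - 3 * ((∫ z : E, ‖z‖ ^ 3 ∂(stdGaussian E)) / R)) * ρ.real Set.univ) ≤
      ∫⁻ x, ∫⁻ z, ENNReal.ofReal (‖z - g (x + σ • z)‖ ^ 2) ∂(stdGaussian E) ∂ρ := by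
  set T : ι → E → ℝ := fun i y => max (-R) (min R ⟪g y, u i⟫) with hT
  have hTm : ∀ i, Measurable (T i) := fun i =>
    measurable_const.max (measurable_const.min (hg.inner_const))
  have hTb : ∀ i y, |T i y| ≤ R := fun i y =>
    abs_le.2 ⟨le_max_left _ _, max_le (by linarith) (min_le_left _ _)⟩
  set h : E × E → ℝ := fun p => ∑ i, (⟪p.2, u i⟫ ^ 2 -
    2 * (⟪p.2, u i⟫ * T i (p.1 + σ • p.2)) - 3 * (‖p.2‖ ^ 3 / R)) with hh
  have hpt : ∀ p : E × E, h p ≤ ‖p.2 - g (p.1 + σ • p.2)‖ ^ 2 := fun p => by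
    refine le_trans (Finset.sum_le_sum fun i _ => ?_)
      (hu.sum_inner_products_le (x := p.2 - g (p.1 + σ • p.2)) (s := Finset.univ))
    have h1 := sq_sub_clip_le ⟪p.2, u i⟫ ⟪g (p.1 + σ • p.2), u i⟫ hR
    have h2 : |⟪p.2, u i⟫| ^ 3 ≤ ‖p.2‖ ^ 3 := by
      gcongr
      simpa [hu.1 i] using abs_real_inner_le_norm p.2 (u i)
    rw [real_inner_comm (_ - _), inner_sub_left, Real.norm_eq_abs, sq_abs]
    refine le_trans ?_ h1
    gcongr
  have i1 : ∀ i, Integrable (fun p : E × E => ⟪p.2, u i⟫ ^ 2) (ρ.prod (stdGaussian E)) :=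
    fun i => (integrable_inner_sq_stdGaussian (u i)).comp_snd ρ
  have i2 : ∀ i, Integrable (fun p : E × E => ⟪p.2, u i⟫ * T i (p.1 + σ • p.2))
      (ρ.prod (stdGaussian E)) := fun i => by
    refine ((integrable_norm_stdGaussian (E := E)).comp_snd ρ |>.mul_const R).mono'
      ?_ (ae_of_all _ fun p => ?_)
    · exact ((by fun_prop : Measurable fun p : E × E => ⟪p.2, u i⟫).mul
        ((hTm i).comp (by fun_prop))).aestronglyMeasurable
    · rw [norm_mul]
      gcongr
      · simpa [hu.1 i] using abs_real_inner_le_norm p.2 (u i)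
      · exact hTb _ _
  have i3 : Integrable (fun p : E × E => ‖p.2‖ ^ 3 / R) (ρ.prod (stdGaussian E)) :=
    ((integrable_norm_pow_three_stdGaussian (E := E)).comp_snd ρ).div_const R
  have i12 : ∀ i, Integrable (fun p : E × E => ⟪p.2, u i⟫ ^ 2 -
      2 * (⟪p.2, u i⟫ * T i (p.1 + σ • p.2))) (ρ.prod (stdGaussian E)) :=
    fun i => (i1 i).sub ((i2 i).const_mul 2)
  have i4 : ∀ i, Integrable (fun p : E × E => ⟪p.2, u i⟫ ^ 2 -
      2 * (⟪p.2, u i⟫ * T i (p.1 + σ • p.2)) - 3 * (‖p.2‖ ^ 3 / R)) (ρ.prod (stdGaussian E)) :=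
    fun i => (i12 i).sub (i3.const_mul 3)
  have hi : Integrable h (ρ.prod (stdGaussian E)) := integrable_finsetSum _ fun i _ => i4 i
  have e2 : ∀ i, ∫ p : E × E, ⟪p.2, u i⟫ * T i (p.1 + σ • p.2) ∂(ρ.prod (stdGaussian E)) ≤
      R * κ * ρ.real Set.univ := fun i => by
    rw [integral_prod _ (i2 i)]
    have h1 := (le_abs_self _).trans (hdec (fun y => R⁻¹ * T i y) ((hTm i).const_mul _) (fun y => by
      rw [abs_mul, abs_of_pos (inv_pos.2 hR), inv_mul_le_iff₀ hR, mul_one]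
      exact hTb i y) i)
    simp_rw [mul_assoc R⁻¹, integral_const_mul] at h1
    rw [inv_mul_le_iff₀ hR] at h1
    simp_rw [mul_comm ⟪_, u i⟫, mul_assoc R]
    exact h1
  have hint : Fintype.card ι * (1 - 2 * (R * κ) - 3 * ((∫ z : E, ‖z‖ ^ 3 ∂(stdGaussian E)) / R)) *
      ρ.real Set.univ ≤ ∫ p, h p ∂(ρ.prod (stdGaussian E)) := by
    rw [hh, integral_finsetSum _ fun i _ => i4 i]
    rw [← nsmul_eq_mul, smul_mul_assoc, Fintype.card, ← Finset.sum_const]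
    refine Finset.sum_le_sum fun i _ => ?_
    rw [integral_sub (i12 i) (i3.const_mul 3),
      integral_sub (i1 i) ((i2 i).const_mul 2), integral_const_mul, integral_const_mul,
      integral_fun_snd (fun z : E => ⟪z, u i⟫ ^ 2), integral_fun_snd (fun z : E => ‖z‖ ^ 3 / R),
      integral_inner_sq_stdGaussian, hu.1 i, integral_div]
    simp only [smul_eq_mul]
    nlinarith [e2 i]
  refine (ENNReal.ofReal_le_ofReal hint).trans ((ofReal_integral_le_lintegral_ofReal hi).trans ?_)
  refine (lintegral_mono fun p => ENNReal.ofReal_le_ofReal (hpt p)).trans_eq ?_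
  refine lintegral_prod _ (Measurable.aemeasurable ?_)
  have : Measurable fun p : E × E => g (p.1 + σ • p.2) := hg.comp (by fun_prop)
  fun_prop

end Loss

/-! ### Parametrizations with nearly orthonormal tangent frames -/

theorem exists_orthonormal_image {d : ℕ} {E : Type*} [NormedAddCommGroup E]
    [InnerProductSpace ℝ E] [FiniteDimensional ℝ E] (A : EuclideanSpace ℝ (Fin d) →L[ℝ] E)
    (hA : Function.Injective A) :
    ∃ w : Fin d → EuclideanSpace ℝ (Fin d), Orthonormal ℝ fun i => A (w i) := by
  have hrank : Module.finrank ℝ A.range = d := by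
    have := LinearMap.finrank_range_of_inj (f := (A : EuclideanSpace ℝ (Fin d) →ₗ[ℝ] E)) hA
    simpa using this
  set b := (stdOrthonormalBasis ℝ A.range).reindex (finCongr hrank)
  choose w hw using fun i => (b i).2
  refine ⟨w, ?_⟩
  have := b.orthonormal.comp_linearIsometry A.range.subtypeₗᵢ
  convert this using 2 with i
  exact hw i

open Filter Topology in
/-- Around each of its points, `M` is parametrized by a globally defined, compactly supported `C¹`
map `f`, for which the images of fixed vectors `w i` under all derivatives are close to a fixed
orthonormal family. -/
theorem IsEmbeddedSubmanifold.exists_parametrization {n d : ℕ}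
    {M : Set (EuclideanSpace ℝ (Fin n))} (hM : IsEmbeddedSubmanifold d M)
    {x : EuclideanSpace ℝ (Fin n)} (hx : x ∈ M) {η : ℝ} (hη : 0 < η) :
    ∃ (U : Set (EuclideanSpace ℝ (Fin n))) (W : Set (EuclideanSpace ℝ (Fin d)))
      (f : EuclideanSpace ℝ (Fin d) → EuclideanSpace ℝ (Fin n))
      (w : Fin d → EuclideanSpace ℝ (Fin d)) (u : Fin d → EuclideanSpace ℝ (Fin n)) (K : NNReal),
      IsOpen U ∧ x ∈ U ∧ IsOpen W ∧ ContDiff ℝ 1 f ∧ HasCompactSupport f ∧ Set.InjOn f W ∧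
      LipschitzOnWith K f W ∧ M ∩ U ⊆ f '' W ∧ Orthonormal ℝ u ∧
      ∀ v ∈ W, ∀ i, ‖fderiv ℝ f v (w i) - u i‖ ≤ η := by
  obtain ⟨U, V, f, hU, hxU, hV, hf, hinj, hemb, hfV⟩ := hM x hx
  obtain ⟨v₀, hv₀, rfl⟩ : x ∈ f '' V := hfV ▸ ⟨hx, hxU⟩
  obtain ⟨w, hw⟩ := exists_orthonormal_image (fderiv ℝ f v₀) (hinj v₀ hv₀)
  obtain ⟨r, hr, hrV⟩ := Metric.isOpen_iff.1 hV v₀ hv₀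
  let χ : ContDiffBump v₀ := ⟨r / 4, r / 2, by positivity, by linarith⟩
  have hχV : tsupport χ ⊆ V := by
    rw [χ.tsupport_eq]
    exact (Metric.closedBall_subset_ball (by change r / 2 < r; linarith)).trans hrV
  set g : EuclideanSpace ℝ (Fin d) → EuclideanSpace ℝ (Fin n) := fun v => χ v • f v with hg
  have hgC : ContDiff ℝ 1 g := by
    refine contDiff_iff_contDiffAt.2 fun v => ?_
    by_cases hv : v ∈ V
    · exact χ.contDiff.contDiffAt.smul (hf.contDiffAt (hV.mem_nhds hv))
    · have h0 : g =ᶠ[𝓝 v] fun _ => 0 := by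
        filter_upwards [notMem_tsupport_iff_eventuallyEq.1 fun h => hv (hχV h)] with y hy
        simp [hg, hy]
      exact contDiffAt_const.congr_of_eventuallyEq h0
  have hgf : g =ᶠ[𝓝 v₀] f := by
    filter_upwards [χ.eventuallyEq_one] with y hy
    simp [hg, hy]
  have hev : ∀ᶠ v in 𝓝 v₀, ∀ i, ‖fderiv ℝ g v (w i) - fderiv ℝ f v₀ (w i)‖ < η := by
    refine eventually_all.2 fun i => ?_
    have hc : Continuous fun v => ‖fderiv ℝ g v (w i) - fderiv ℝ f v₀ (w i)‖ :=
      (((hgC.continuous_fderiv_apply one_ne_zero).comp (.prodMk_left (w i))).sub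
        continuous_const).norm
    refine hc.continuousAt.eventually_lt continuousAt_const ?_
    simp [hgf.fderiv_eq, hη]
  obtain ⟨K, t, ht, hLip⟩ := hgC.contDiffAt.exists_lipschitzOnWith (x := v₀)
  obtain ⟨W, hWsub, hWo, hv₀W⟩ := mem_nhds_iff.1
    (inter_mem (inter_mem (hV.mem_nhds hv₀) hgf) (inter_mem hev ht))
  obtain ⟨O, hO, hOW⟩ := hemb.isInducing.isOpen_iff.1 (hWo.preimage continuous_subtype_val)
  have hiff : ∀ v : V, f v ∈ O ↔ (v : EuclideanSpace ℝ (Fin d)) ∈ W := fun v =>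
    Set.ext_iff.1 hOW v
  refine ⟨U ∩ O, W, g, w, fun i => fderiv ℝ f v₀ (w i), K, hU.inter hO,
    ⟨hxU, (hiff ⟨v₀, hv₀⟩).2 hv₀W⟩, hWo, hgC, χ.hasCompactSupport.smul_right, ?_,
    hLip.mono fun v hv => (hWsub hv).2.2, ?_, hw, fun v hv i => ((hWsub hv).2.1 i).le⟩
  · intro a ha b hb hab
    have hab' : f a = f b := by
      rw [← show g a = f a from (hWsub ha).1.2, ← show g b = f b from (hWsub hb).1.2, hab]
    exact congrArg Subtype.val
      (hemb.injective (a₁ := ⟨a, (hWsub ha).1.1⟩) (a₂ := ⟨b, (hWsub hb).1.1⟩) hab')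
  · rintro y ⟨hyM, hyU, hyO⟩
    obtain ⟨v, hv, rfl⟩ : y ∈ f '' V := hfV ▸ ⟨hyM, hyU⟩
    have hvW := (hiff ⟨v, hv⟩).1 hyO
    exact ⟨v, hvW, (hWsub hvW).1.2⟩

theorem euclideanHausdorffMeasure_image_eq_zero {n d : ℕ}
    {f : EuclideanSpace ℝ (Fin d) → EuclideanSpace ℝ (Fin n)}
    {s : Set (EuclideanSpace ℝ (Fin d))} {K : NNReal} (hf : LipschitzOnWith K f s)
    (hs : volume s = 0) : Measure.euclideanHausdorffMeasure d (f '' s) = 0 := by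
  rw [← EuclideanSpace.euclideanHausdorffMeasure_eq_volume] at hs
  rw [Measure.euclideanHausdorffMeasure_def, Measure.smul_apply, ENNReal.smul_def,
    smul_eq_mul, mul_eq_zero] at hs ⊢
  refine hs.imp id fun h => ?_
  have := hf.hausdorffMeasure_image_le (Nat.cast_nonneg d)
  rw [h, mul_zero] at this
  exact nonpos_iff_eq_zero.1 this

/-- A measure with a density with respect to the volume of a parametrized piece of a submanifold is
the image of an absolutely continuous measure on the parameter space. Only one direction of the
area formula is needed: Lipschitz maps send null sets to null sets. -/
theorem exists_map_eq_of_absolutelyContinuous {n d : ℕ}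
    {f : EuclideanSpace ℝ (Fin d) → EuclideanSpace ℝ (Fin n)} (hf : Continuous f)
    {W : Set (EuclideanSpace ℝ (Fin d))} (hW : IsOpen W) (hinj : Set.InjOn f W) {K : NNReal}
    (hLip : LipschitzOnWith K f W) {ρ : Measure (EuclideanSpace ℝ (Fin n))} [IsFiniteMeasure ρ]
    (hρ : ρ ≪ Measure.euclideanHausdorffMeasure d) (hρW : ρ (f '' W)ᶜ = 0) :
    ∃ ν : Measure (EuclideanSpace ℝ (Fin d)),
      IsFiniteMeasure ν ∧ ν ≪ volume ∧ ν Wᶜ = 0 ∧ ν.map f = ρ := by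
  set e : W → EuclideanSpace ℝ (Fin n) := fun v => f v with he
  have hemb : MeasurableEmbedding e :=
    hf.continuousOn.measurableEmbedding hW.measurableSet hinj
  have hmap : ((ρ.comap e).map Subtype.val).map f = ρ := by
    rw [Measure.map_map hf.measurable measurable_subtype_coe]
    change (ρ.comap e).map e = ρ
    rw [hemb.map_comap]
    refine Measure.restrict_eq_self_of_ae_mem (mem_ae_iff.2 ?_)
    convert hρW
    ext y
    simp [he]
  refine ⟨(ρ.comap e).map Subtype.val, ⟨?_⟩, ?_, ?_, hmap⟩
  · rw [← Set.preimage_univ (f := f), ← Measure.map_apply hf.measurable .univ, hmap]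
    exact measure_lt_top ρ _
  · refine Measure.AbsolutelyContinuous.mk fun N hN hN0 => ?_
    rw [Measure.map_apply measurable_subtype_coe hN, hemb.comap_apply]
    have himg : e '' (Subtype.val ⁻¹' N) = f '' (N ∩ W) := by
      ext y
      simp [he, and_comm]
    rw [himg]
    exact hρ (euclideanHausdorffMeasure_image_eq_zero (hLip.mono Set.inter_subset_right)
      (measure_mono_null Set.inter_subset_left hN0))
  · rw [Measure.map_apply measurable_subtype_coe hW.measurableSet.compl]
    simp

/-! ### Decorrelation on a parametrized piece -/

section Piece

variable {E : Type*} [NormedAddCommGroup E] [InnerProductSpace ℝ E] [FiniteDimensional ℝ E]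
  [MeasurableSpace E] [BorelSpace E]
  {F : Type*} [NormedAddCommGroup F] [MeasurableSpace F] [BorelSpace F]

local notation "⟪" x ", " y "⟫" => inner ℝ x y

theorem integrable_mul_inner_prod_stdGaussian (ν : Measure F) [IsFiniteMeasure ν] {f : F → E}
    (hf : Continuous f) {X : F → E} (hX : Continuous X) {C : ℝ} (hC : ∀ v, ‖X v‖ ≤ C) {G : E → ℝ}
    (hG : Measurable G) (hb : ∀ y, |G y| ≤ 1) (σ : ℝ) :
    Integrable (fun p : F × E => G (f p.1 + σ • p.2) * ⟪p.2, X p.1⟫)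
      (ν.prod (stdGaussian E)) := by
  refine (((integrable_norm_stdGaussian (E := E)).comp_snd ν).mul_const C).mono' ?_
    (ae_of_all _ fun p => ?_)
  · exact ((hG.comp (by fun_prop : Measurable fun p : F × E => f p.1 + σ • p.2)).mul
      (by fun_prop : Continuous fun p : F × E => ⟪p.2, X p.1⟫).measurable).aestronglyMeasurable
  · rw [norm_mul, Real.norm_eq_abs, Real.norm_eq_abs]
    calc _ ≤ 1 * (‖p.2‖ * ‖X p.1‖) := by
          gcongr
          exacts [hb _, abs_real_inner_le_norm _ _]
      _ ≤ ‖p.2‖ * C := by rw [one_mul]; gcongr; exact hC _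

variable [NormedSpace ℝ F] [FiniteDimensional ℝ F]

open Filter Topology in
/-- Decorrelation for a fixed direction `u`, which is nearly tangent to the piece. -/
theorem eventually_abs_integral_inner_le (μ : Measure F) [μ.IsAddHaarMeasure] (ν : Measure F)
    [IsFiniteMeasure ν] (hν : ν ≪ μ) {f : F → E} (hf : ContDiff ℝ 1 f) (hfs : HasCompactSupport f)
    {W : Set F} (hW : ν Wᶜ = 0) (w : F) (u : E) {η : ℝ}
    (hη : ∀ v ∈ W, ‖fderiv ℝ f v w - u‖ ≤ η) {κ : ℝ} (hκ : 0 < κ) :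
    ∀ᶠ σ in 𝓝[>] (0 : ℝ), ∀ G : E → ℝ, Measurable G → (∀ y, |G y| ≤ 1) →
      |∫ x, ∫ z, G (x + σ • z) * ⟪z, u⟫ ∂(stdGaussian E) ∂(ν.map f)| ≤
        κ + η * (∫ z : E, ‖z‖ ∂(stdGaussian E)) * ν.real Set.univ := by
  have hDf : Continuous fun v => fderiv ℝ f v w :=
    (hf.continuous_fderiv_apply one_ne_zero).comp (.prodMk_left w)
  obtain ⟨C, hC⟩ := (hfs.fderiv_apply ℝ w).exists_bound_of_continuous hDf
  filter_upwards [eventually_abs_integral_inner_fderiv_le μ ν hν hf w hC hκ] with σ hσ G hG hb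
  have hm : Measurable fun p : E × E => G (p.1 + σ • p.2) * ⟪p.2, u⟫ :=
    (hG.comp (by fun_prop)).mul (by fun_prop)
  rw [integral_map hf.continuous.aemeasurable
    hm.stronglyMeasurable.integral_prod_right.aestronglyMeasurable]
  have i1 := integrable_mul_inner_prod_stdGaussian ν hf.continuous hDf hC hG hb σ
  have i2 := integrable_mul_inner_prod_stdGaussian ν hf.continuous (X := fun _ => u)
    continuous_const (fun _ => le_rfl) hG hb σ
  have hsub := integral_integral_sub i2 i1
  have hbd : |∫ v, ∫ z, (G (f v + σ • z) * ⟪z, u⟫ - G (f v + σ • z) * ⟪z, fderiv ℝ f v w⟫)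
      ∂(stdGaussian E) ∂ν| ≤ η * (∫ z : E, ‖z‖ ∂(stdGaussian E)) * ν.real Set.univ := by
    refine norm_integral_le_of_norm_le_const (μ := ν) (f := fun v => ∫ z, (G (f v + σ • z) * ⟪z, u⟫ -
      G (f v + σ • z) * ⟪z, fderiv ℝ f v w⟫) ∂(stdGaussian E)) ?_
    filter_upwards [mem_ae_iff.2 hW] with v hv
    rw [← integral_const_mul]
    refine norm_integral_le_of_norm_le (integrable_norm_stdGaussian.const_mul η)
      (ae_of_all _ fun z => ?_)
    rw [← mul_sub, ← inner_sub_right, norm_mul, Real.norm_eq_abs, Real.norm_eq_abs]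
    calc _ ≤ 1 * (‖z‖ * ‖u - fderiv ℝ f v w‖) := by
          gcongr
          exacts [hb _, abs_real_inner_le_norm _ _]
      _ ≤ η * ‖z‖ := by
          rw [one_mul, mul_comm, norm_sub_rev]
          gcongr
          exact hη v hv
  rw [hsub] at hbd
  have h1 := hσ G hG hb
  rw [abs_le] at *
  constructor <;> linarith

end Piece

/-! ### The lower bound -/

open Filter Topology in
/-- Every point of `M` has a neighbourhood `U` such that the loss bound holds for the restriction
of the data law to any measurable part `B` of `U`. The noise levels for which it holds depend on
`B`, but not on the predictor. -/
theorem exists_nhds_eventually_le_setLIntegral {n d : ℕ} {M : Set (EuclideanSpace ℝ (Fin n))}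
    (hM : IsEmbeddedSubmanifold d M) (p : EuclideanSpace ℝ (Fin n) → ℝ≥0∞)
    [IsFiniteMeasure (dataLaw d M p)] {δ : ℝ} (hδ : 0 < δ) {x : EuclideanSpace ℝ (Fin n)}
    (hx : x ∈ M) :
    ∃ U, IsOpen U ∧ x ∈ U ∧ ∀ B ⊆ U, MeasurableSet B → ∀ᶠ σ in 𝓝[>] (0 : ℝ),
      ∀ g : EuclideanSpace ℝ (Fin n) → EuclideanSpace ℝ (Fin n), Measurable g →
        ENNReal.ofReal (d - δ) * dataLaw d M p B ≤
          ∫⁻ x in B, noisePredictionLoss g σ x ∂(dataLaw d M p) := by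
  set A : ℝ := ∫ z, ‖z‖ ∂(stdGaussian (EuclideanSpace ℝ (Fin n))) with hA
  set T : ℝ := ∫ z, ‖z‖ ^ 3 ∂(stdGaussian (EuclideanSpace ℝ (Fin n))) with hT
  have hA0 : 0 ≤ A := integral_nonneg fun _ => norm_nonneg _
  have hT0 : 0 ≤ T := integral_nonneg fun _ => by positivity
  -- The truncation level `R` makes the cubic error `3 T / R` at most `δ / (2 (d + 1))`, and the
  -- correlation bound `κ` makes `2 R κ` equal to `δ / (2 (d + 1))`.
  set R : ℝ := 6 * (d + 1) * (T + 1) / δ with hR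
  have hR0 : 0 < R := by positivity
  set κ : ℝ := δ / (4 * R * (d + 1)) with hκ
  have hκ0 : 0 < κ := by positivity
  set η : ℝ := κ / 2 / (A + 1) with hη
  have hη0 : 0 < η := by positivity
  obtain ⟨U, W, f, w, u, K, hU, hxU, hW, hf, hfs, hinj, hLip, hMU, hu, hclose⟩ :=
    hM.exists_parametrization hx hη0
  refine ⟨U, hU, hxU, fun B hBU hB => ?_⟩
  set ρ := (dataLaw d M p).restrict B with hρ
  have hρB : ρ Set.univ = dataLaw d M p B := by simp [hρ]
  rcases eq_or_ne (ρ Set.univ) 0 with h0 | h0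
  · refine Eventually.of_forall fun σ g hg => ?_
    rw [← hρB, h0, mul_zero]
    exact zero_le
  have hpos : 0 < ρ.real Set.univ := ENNReal.toReal_pos h0 (measure_ne_top _ _)
  have hfW : MeasurableSet (f '' W) :=
    hW.measurableSet.image_of_continuousOn_injOn hf.continuous.continuousOn hinj
  have hac : dataLaw d M p ≪ volumeOn d M := withDensity_absolutelyContinuous _ _
  have hρac : ρ ≪ Measure.euclideanHausdorffMeasure d :=
    Measure.restrict_le_self.absolutelyContinuous.trans
      (hac.trans Measure.restrict_le_self.absolutelyContinuous)
  have hρW : ρ (f '' W)ᶜ = 0 := by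
    rw [hρ, Measure.restrict_apply hfW.compl]
    refine hac ?_
    rw [volumeOn, Measure.restrict_apply (hfW.compl.inter hB)]
    refine measure_mono_null (t := ∅) ?_ measure_empty
    rintro y ⟨⟨hy, hyB⟩, hyM⟩
    exact hy (hMU ⟨hyM, hBU hyB⟩)
  obtain ⟨ν, hνfin, hνac, hνW, hνρ⟩ :=
    exists_map_eq_of_absolutelyContinuous hf.continuous hW hinj hLip hρac hρW
  have hνuniv : ν.real Set.univ = ρ.real Set.univ := by
    rw [← hνρ, map_measureReal_apply hf.continuous.measurable .univ, Set.preimage_univ]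
  filter_upwards [eventually_all.2 fun i => eventually_abs_integral_inner_le volume ν hνac hf hfs
    hνW (w i) (u i) (fun v hv => hclose v hv i)
    (show 0 < κ / 2 * ρ.real Set.univ by positivity)] with σ hσ g hg
  have hdec : ∀ G : EuclideanSpace ℝ (Fin n) → ℝ, Measurable G → (∀ y, |G y| ≤ 1) → ∀ i,
      |∫ x, ∫ z, G (x + σ • z) * inner ℝ z (u i) ∂(stdGaussian (EuclideanSpace ℝ (Fin n))) ∂ρ| ≤
        κ * ρ.real Set.univ := by
    intro G hG hb i
    have h1 := hσ i G hG hb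
    rw [hνρ, hνuniv, ← hA] at h1
    refine h1.trans ?_
    have h2 : η * A ≤ κ / 2 := by
      calc η * A ≤ η * (A + 1) := by gcongr; linarith
        _ = κ / 2 := by rw [hη]; field_simp
    nlinarith
  have hmain := ofReal_le_lintegral_norm_sub_sq ρ hu hR0 hdec hg
  refine le_trans ?_ hmain
  have hconst : (d : ℝ) - δ ≤ Fintype.card (Fin d) * (1 - 2 * (R * κ) - 3 * (T / R)) := by
    have h1 : 2 * (R * κ) = δ / (2 * (d + 1)) := by rw [hκ]; field_simp; ring
    have h2 : 3 * (T / R) ≤ δ / (2 * (d + 1)) := by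
      calc 3 * (T / R) ≤ 3 * ((T + 1) / R) := by gcongr; linarith
        _ = δ / (2 * (d + 1)) := by rw [hR]; field_simp; ring
    have h3 : (d : ℝ) * (δ / (d + 1)) ≤ δ := by
      rw [mul_div_assoc', div_le_iff₀ (by positivity)]
      nlinarith
    have h4 : δ / (2 * (d + 1)) = δ / (d + 1) / 2 := by field_simp
    have hd : (0 : ℝ) ≤ d := Nat.cast_nonneg d
    rw [Fintype.card_fin]
    nlinarith
  calc ENNReal.ofReal (d - δ) * dataLaw d M p B
      = ENNReal.ofReal ((d - δ) * ρ.real Set.univ) := by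
        rw [ENNReal.ofReal_mul' hpos.le, ← hρB, ofReal_measureReal]
    _ ≤ _ := ENNReal.ofReal_le_ofReal (by gcongr)

open Filter Topology in
theorem eventually_le_lintegral_noisePredictionLoss {n d : ℕ}
    {M : Set (EuclideanSpace ℝ (Fin n))} (hM : IsEmbeddedSubmanifold d M)
    (p : EuclideanSpace ℝ (Fin n) → ℝ≥0∞) [IsProbabilityMeasure (dataLaw d M p)] {δ : ℝ}
    (hδ : 0 < δ) :
    ∀ᶠ σ in 𝓝[>] (0 : ℝ),
      ∀ g : EuclideanSpace ℝ (Fin n) → EuclideanSpace ℝ (Fin n), Measurable g →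
        ENNReal.ofReal (d - δ) ≤ ∫⁻ x, noisePredictionLoss g σ x ∂(dataLaw d M p) := by
  rcases le_or_gt ((d : ℝ) - δ) 0 with hd | hd
  · refine Eventually.of_forall fun σ g _ => ?_
    rw [ENNReal.ofReal_of_nonpos hd]
    exact zero_le
  set μ := dataLaw d M p with hμ
  choose! U hUo hxU hU using
    fun x (hx : x ∈ M) => exists_nhds_eventually_le_setLIntegral hM p (half_pos hδ) hx
  obtain ⟨t, htM, htc, hcover⟩ := TopologicalSpace.countable_cover_nhdsWithin
    fun x hx => mem_nhdsWithin_of_mem_nhds ((hUo x hx).mem_nhds (hxU x hx))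
  have hconc : ∀ S : Set (EuclideanSpace ℝ (Fin n)), MeasurableSet S → M ⊆ S → μ Sᶜ = 0 := by
    intro S hS hMS
    refine withDensity_absolutelyContinuous (volumeOn d M) p ?_
    rw [volumeOn, Measure.restrict_apply hS.compl]
    exact measure_mono_null (t := ∅) (fun y hy => hy.1 (hMS hy.2)) measure_empty
  have htne : t.Nonempty := by
    rw [Set.nonempty_iff_ne_empty]
    rintro rfl
    have := hconc ∅ .empty (by simpa using hcover)
    simp at this
  obtain ⟨s, hs⟩ := htc.exists_eq_range htne
  have hsM : ∀ k, s k ∈ M := fun k => htM (hs ▸ Set.mem_range_self k)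
  set B : ℕ → Set (EuclideanSpace ℝ (Fin n)) := disjointed fun k => U (s k) with hB
  have hBm : ∀ k, MeasurableSet (B k) :=
    MeasurableSet.disjointed fun k => (hUo _ (hsM k)).measurableSet
  have hBd : Pairwise (Function.onFun Disjoint B) := disjoint_disjointed _
  have hBU : ⋃ k, B k = ⋃ k, U (s k) := iUnion_disjointed
  have htotal : ∑' k, μ (B k) = 1 := by
    rw [← measure_iUnion hBd hBm, ← prob_compl_eq_zero_iff (MeasurableSet.iUnion hBm)]
    refine hconc _ (MeasurableSet.iUnion hBm) ?_
    rw [hBU]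
    refine hcover.trans ?_
    rw [hs]
    simp
  -- Finitely many pieces carry enough mass to make up for the gap between `δ / 2` and `δ`.
  obtain ⟨N, hN⟩ : ∃ N : ℕ, ENNReal.ofReal (d - δ) ≤
      ENNReal.ofReal (d - δ / 2) * ∑ k ∈ Finset.range N, μ (B k) := by
    have h1 : Tendsto (fun N : ℕ => ENNReal.ofReal (d - δ / 2) *
        ∑ k ∈ Finset.range N, μ (B k)) atTop (𝓝 (ENNReal.ofReal (d - δ / 2) * 1)) :=
      ENNReal.Tendsto.const_mul (htotal ▸ ENNReal.tendsto_nat_tsum fun k => μ (B k))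
        (Or.inr ENNReal.ofReal_ne_top)
    rw [mul_one] at h1
    have h2 : ENNReal.ofReal (d - δ) < ENNReal.ofReal (d - δ / 2) :=
      (ENNReal.ofReal_lt_ofReal_iff (by linarith)).2 (by linarith)
    obtain ⟨N, hN⟩ := (h1.eventually_const_lt h2).exists
    exact ⟨N, hN.le⟩
  have hev := (Finset.eventually_all (Finset.range N)).2 fun k _ =>
    hU (s k) (hsM k) (B k) (disjointed_subset _ k) (hBm k)
  filter_upwards [hev] with σ hσ g hg
  calc ENNReal.ofReal (d - δ) ≤ ENNReal.ofReal (d - δ / 2) * ∑ k ∈ Finset.range N, μ (B k) := hN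
    _ ≤ ∑ k ∈ Finset.range N, ∫⁻ x in B k, noisePredictionLoss g σ x ∂μ := by
        rw [Finset.mul_sum]
        exact Finset.sum_le_sum fun k hk => hσ k hk g hg
    _ = ∫⁻ x in ⋃ k ∈ Finset.range N, B k, noisePredictionLoss g σ x ∂μ :=
        (lintegral_biUnion_finset (fun i _ j _ hij => hBd hij) (fun k _ => hBm k) _).symm
    _ ≤ _ := setLIntegral_le_lintegral _ _

theorem theorem1 (n d : ℕ) (M : Set (EuclideanSpace ℝ (Fin n)))
    (hM : IsEmbeddedSubmanifold d M)
    (p : EuclideanSpace ℝ (Fin n) → ℝ≥0∞) (hp : Measurable p)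
    (hprob : IsProbabilityMeasure (dataLaw d M p)) :
    ∀ δ : ℝ, 0 < δ → ∃ σ₀ : ℝ, 0 < σ₀ ∧ ∀ σ : ℝ, 0 < σ → σ < σ₀ →
      (∀ s : EuclideanSpace ℝ (Fin n) → EuclideanSpace ℝ (Fin n), Measurable s →
        ENNReal.ofReal ((d : ℝ) - δ) ≤ ∫⁻ x, dsmLoss s σ x ∂(dataLaw d M p)) ∧
      (∀ εθ : EuclideanSpace ℝ (Fin n) → EuclideanSpace ℝ (Fin n), Measurable εθ →
        ENNReal.ofReal ((d : ℝ) - δ) ≤ ∫⁻ x, noisePredictionLoss εθ σ x ∂(dataLaw d M p)) := by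
  intro δ hδ
  obtain ⟨σ₀, hσ₀, hsub⟩ := mem_nhdsGT_iff_exists_Ioo_subset.1
    (eventually_le_lintegral_noisePredictionLoss hM p hδ)
  refine ⟨σ₀, hσ₀, fun σ hσ hσ' => ⟨fun s hs => ?_, hsub ⟨hσ, hσ'⟩⟩⟩
  simp_rw [dsmLoss_eq_noisePredictionLoss s hσ.ne']
  exact hsub ⟨hσ, hσ'⟩ _ (hs.const_smul σ).neg
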